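/- Let $N$ be a finite index set and let $(N^+,N^-)$ be a partition of $N$ into two disjoint, possibly empty, sets. For a vector $c$ and an index set $S$ write $c(S)=\sum_{i\in S}c_i$. Let $$X=\Big\{(x,y,t)\in\{0,1\}^N\times\mathbb{R}_+^N\times\mathbb{R}_+:\ \big(y(N^+)-y(N^-)\big)^2\le t,\ \ y_i(1-x_i)=0\ \text{ for all } i\in N\Big\}.$$ Use the conventions $a/0=\infty$ for $a>0$ and $0/0=0$. For pairwise disjoint (possibly empty) sets $M,L,R,U\subseteq N$, consider the inequality $$t\ \ge\ \min_{\lambda,\mu,\lambda_0,\mu_0,\zeta}\ \frac{\big(y(L)-\lambda_0\big)^2}{1-x(R)-x(U)+\mu(R)+\mu_0}+\sum_{i\in R}\frac{(y_i-\lambda_i)^2}{x_i-\mu_i}+\frac{\big(y(U)-y(M)+\lambda_0+\lambda(R)+\zeta\big)^2}{x(U)-\mu_0}\qquad (I_{M;L,R,U})$$ where the minimum (a value in $[0,\infty]$) is over all $\lambda,\mu\in\mathbb{R}_+^R$ and $\lambda_0,\mu_0,\zeta\in\mathbb{R}_+$ satisfying $$1-x(R)-x(U)+\mu(R)+\mu_0\ge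 0,\qquad \mu_i\le x_i\ \ (i\in R),\qquad \mu_0\le x(U).$$ Then the closure of the convex hull of $X$ is exactly the set of all $(x,y,t)\in\mathbb{R}^N\times\mathbb{R}^N\times\mathbb{R}$ such that $0\le x_i\le 1$ and $y_i\ge 0$ for all $i\in N$, such that $(I_{N^-;L,R,U})$ holds for every partition $(L,R,U)$ of $N^+$ (parts may be empty), and such that $(I_{N^+;L,R,U})$ holds for every partition $(L,R,U)$ of $N^-$ (parts may be empty); at every point of this set each of these minima is attained. -/

import Mathlib

/-- The mixed-integer epigraph `X` of the rank-one quadratic `(y(N⁺) - y(N⁻))²` with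
nonnegative continuous variables `y` and indicator variables `x`; its points are triples
`(x, y, t)`. -/
def rankOneSet {ι : Type*} (Np Nm : Finset ι) : Set ((ι → ℝ) × (ι → ℝ) × ℝ) :=
  {p | (∀ i, p.1 i = 0 ∨ p.1 i = 1) ∧ (∀ i, 0 ≤ p.2.1 i) ∧ 0 ≤ p.2.2 ∧
    ((∑ i ∈ Np, p.2.1 i) - ∑ i ∈ Nm, p.2.1 i) ^ 2 ≤ p.2.2 ∧
    ∀ i, p.2.1 i * (1 - p.1 i) = 0}

/-- `(L, R, U)` is a partition of `S`; parts may be empty. -/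
structure IsTripartition {ι : Type*} [DecidableEq ι] (S L R U : Finset ι) : Prop where
  disjoint_L_R : Disjoint L R
  disjoint_L_U : Disjoint L U
  disjoint_R_U : Disjoint R U
  union_eq : L ∪ R ∪ U = S

/-- The extended-valued quotient `a / b` with `a / 0 = ∞` for `a > 0` and `0 / 0 = 0`.
It is only used with `0 ≤ a` and `0 ≤ b`. -/
noncomputable def extQuot (a b : ℝ) : EReal :=
  if b = 0 then (if a = 0 then 0 else ⊤) else ((a / b : ℝ) : EReal)

/-- The constraints on the auxiliary variables `(λ, μ, λ₀, μ₀, ζ)`. The vectors `λ, μ` are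
indexed by `R`: only their entries in `R` occur, here and in the objective. -/
structure AuxFeasible {ι : Type*} (R U : Finset ι) (x : ι → ℝ)
    (lam mu : ι → ℝ) (lam0 mu0 zeta : ℝ) : Prop where
  denom_nonneg : 0 ≤ 1 - (∑ i ∈ R, x i) - (∑ i ∈ U, x i) + (∑ i ∈ R, mu i) + mu0
  mu_le : ∀ i ∈ R, mu i ≤ x i
  mu0_le : mu0 ≤ ∑ i ∈ U, x i
  lam_nonneg : ∀ i ∈ R, 0 ≤ lam i
  mu_nonneg : ∀ i ∈ R, 0 ≤ mu i
  lam0_nonneg : 0 ≤ lam0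
  mu0_nonneg : 0 ≤ mu0
  zeta_nonneg : 0 ≤ zeta

/-- The objective, a sum of ratios of convex quadratic and nonnegative linear terms.
Here `(L, R, U)` partitions one of the two sides `N⁺`, `N⁻`, and `M` is the other side. -/
noncomputable def auxObjective {ι : Type*} (M L R U : Finset ι) (x y : ι → ℝ)
    (lam mu : ι → ℝ) (lam0 mu0 zeta : ℝ) : EReal :=
  extQuot (((∑ i ∈ L, y i) - lam0) ^ 2)
      (1 - (∑ i ∈ R, x i) - (∑ i ∈ U, x i) + (∑ i ∈ R, mu i) + mu0)
    + (∑ i ∈ R, extQuot ((y i - lam i) ^ 2) (x i - mu i))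
    + extQuot (((∑ i ∈ U, y i) - (∑ i ∈ M, y i) + lam0 + (∑ i ∈ R, lam i) + zeta) ^ 2)
      ((∑ i ∈ U, x i) - mu0)

/-- The inequality `t ≥ min_{λ, μ, λ₀, μ₀, ζ} (objective)` over the feasible auxiliary variables:
the minimum exists in the extended reals and is at most `t`. -/
def ExtendedIneq {ι : Type*} (M L R U : Finset ι) (x y : ι → ℝ) (t : ℝ) : Prop :=
  ∃ v : EReal,
    IsLeast {w : EReal | ∃ (lam mu : ι → ℝ) (lam0 mu0 zeta : ℝ),
      AuxFeasible R U x lam mu lam0 mu0 zeta ∧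
      w = auxObjective M L R U x y lam mu lam0 mu0 zeta} v ∧
    v ≤ (t : EReal)

/-!
A fraction `q² / d` is the supremum over `c` of the linear functions `2 c q - c² d`. Hence a bound
on a sum of such fractions is an intersection of closed half-spaces, also at `d = 0`, and the
sublevel sets are compact when the denominators sum to at most `1`. The denominators of the
inequality always sum to `1`; this gives attained minima and closed convex projections. Merging
fractions by Cauchy–Schwarz makes the inequality weaker, so among the tripartitions of one side `S`
the strongest inequality is the one of `(∅, S, ∅)`, where every item of `S` keeps its own fraction.

Say `y(S) ≥ y(M)`. The inequality of `(∅, S, ∅)` provides parts `q i ≤ y i` with sum `y(S) - y(M)`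
and numbers `d i ≤ x i` with sum at most `1`. Take disjoint events of probabilities `d i` and let
`y` be `q i / d i` in coordinate `i` on the `i`-th event and `0` in all other coordinates. Such a
random point has mean `q` and expected square `∑ (q i)² / d i ≤ t`, and the indicators outside the
events can be chosen to have mean `x`. What remains, `y - q`, is balanced between the two sides,
and a balanced direction is a recession direction of the closed convex hull.
-/

open Filter Topology

section Fractions

lemma coe_finset_sum_ereal {κ : Type*} (s : Finset κ) (f : κ → ℝ) :
    ((∑ k ∈ s, f k : ℝ) : EReal) = ∑ k ∈ s, (f k : EReal) :=
  map_sum (⟨⟨Real.toEReal, EReal.coe_zero⟩, EReal.coe_add⟩ : ℝ →+ EReal) f s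

lemma extQuot_nonneg {a b : ℝ} (ha : 0 ≤ a) (hb : 0 ≤ b) : 0 ≤ extQuot a b := by
  unfold extQuot
  split_ifs
  · exact le_rfl
  · exact le_top
  · exact_mod_cast div_nonneg ha hb

lemma extQuot_le_extQuot_of_le {a a' b : ℝ} (ha : 0 ≤ a) (hb : 0 ≤ b) (h : a ≤ a') :
    extQuot a b ≤ extQuot a' b := by
  rcases eq_or_ne b 0 with rfl | hb0
  · rcases ha.eq_or_lt with rfl | ha0
    · simpa [extQuot] using extQuot_nonneg h le_rfl
    · simp [extQuot, (ha0.trans_le h).ne']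
  · simp only [extQuot, if_neg hb0, EReal.coe_le_coe_iff]
    gcongr

lemma extQuot_eq_coe_div {a b : ℝ} (h : b = 0 → a = 0) : extQuot a b = ((a / b : ℝ) : EReal) := by
  unfold extQuot
  split_ifs with hb ha
  · simp [ha]
  · exact absurd (h hb) ha
  · rfl

lemma extQuot_sq_le_iff {a b : ℝ} (hb : 0 ≤ b) {e : EReal} :
    extQuot (a ^ 2) b ≤ e ↔ ∀ c : ℝ, ((2 * c * a - c ^ 2 * b : ℝ) : EReal) ≤ e := by
  constructor
  · refine fun h c => le_trans ?_ h
    unfold extQuot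
    split_ifs with hb0 ha
    · simp [hb0, pow_eq_zero_iff two_ne_zero |>.1 ha]
    · exact le_top
    · rw [EReal.coe_le_coe_iff, le_div_iff₀ (hb.lt_of_ne' hb0)]
      nlinarith [sq_nonneg (a - c * b)]
  · intro h
    by_cases hab : b = 0 → a = 0
    · rw [extQuot_eq_coe_div fun hb0 => by simp [hab hb0]]
      convert h (a / b) using 2
      rcases eq_or_ne b 0 with hb0 | hb0
      · simp [hb0]
      · field_simp
        ring
    · obtain ⟨rfl, ha⟩ : b = 0 ∧ a ≠ 0 := by simpa using hab
      have he : e = ⊤ := EReal.eq_top_iff_forall_lt e |>.2 fun r =>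
        lt_of_lt_of_le (by
          have hval : 2 * ((r + 1) / (2 * a)) * a = r + 1 := by field_simp
          rw [EReal.coe_lt_coe_iff, hval]
          linarith) (h ((r + 1) / (2 * a)))
      exact he ▸ le_top

lemma eq_zero_of_extQuot_sq_le {a b r : ℝ} (h : extQuot (a ^ 2) b ≤ r) (hb : b = 0) : a = 0 := by
  by_contra ha
  simp [extQuot, hb, ha] at h

lemma extQuot_sq_le_of_denom_le {a b b' : ℝ} (hb : 0 ≤ b) (h : b ≤ b') :
    extQuot (a ^ 2) b' ≤ extQuot (a ^ 2) b :=
  (extQuot_sq_le_iff (hb.trans h)).2 fun c =>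
    le_trans (EReal.coe_le_coe_iff.2 (by gcongr)) ((extQuot_sq_le_iff hb).1 le_rfl c)

lemma extQuot_sq_sum_le {κ : Type*} {s : Finset κ} {q d : κ → ℝ} (hd : ∀ k ∈ s, 0 ≤ d k) :
    extQuot ((∑ k ∈ s, q k) ^ 2) (∑ k ∈ s, d k) ≤ ∑ k ∈ s, extQuot (q k ^ 2) (d k) := by
  refine (extQuot_sq_le_iff (Finset.sum_nonneg hd)).2 fun c => ?_
  rw [Finset.mul_sum, Finset.mul_sum, ← Finset.sum_sub_distrib, coe_finset_sum_ereal]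
  exact Finset.sum_le_sum fun k hk => (extQuot_sq_le_iff (hd k hk)).1 le_rfl c

variable {κ : Type*} {s : Finset κ} {v : (κ → ℝ) × (κ → ℝ)}

/-- The sum of the fractions `q k ^ 2 / d k` over `s`, where `v = (q, d)`. -/
noncomputable def quadOverLin (s : Finset κ) (v : (κ → ℝ) × (κ → ℝ)) : EReal :=
  ∑ k ∈ s, extQuot (v.1 k ^ 2) (v.2 k)

/-- The linear minorant with slopes `c` of the sum of the fractions `q k ^ 2 / d k`. -/
def quadMinorant (s : Finset κ) (c : κ → ℝ) (v : (κ → ℝ) × (κ → ℝ)) : ℝ :=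
  ∑ k ∈ s, (2 * c k * v.1 k - c k ^ 2 * v.2 k)

lemma quadOverLin_nonneg (hd : ∀ k ∈ s, 0 ≤ v.2 k) : 0 ≤ quadOverLin s v :=
  Finset.sum_nonneg fun k hk => extQuot_nonneg (sq_nonneg _) (hd k hk)

lemma extQuot_le_quadOverLin (hd : ∀ k ∈ s, 0 ≤ v.2 k) {k : κ} (hk : k ∈ s) :
    extQuot (v.1 k ^ 2) (v.2 k) ≤ quadOverLin s v :=
  Finset.single_le_sum (f := fun k => extQuot (v.1 k ^ 2) (v.2 k))
    (fun k hk => extQuot_nonneg (sq_nonneg _) (hd k hk)) hk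

lemma quadMinorant_single [DecidableEq κ] {k : κ} (hk : k ∈ s) (r : ℝ) :
    quadMinorant s (Pi.single k r) v = 2 * r * v.1 k - r ^ 2 * v.2 k := by
  unfold quadMinorant
  rw [Finset.sum_eq_single_of_mem k hk fun j _ hj => by simp [hj], Pi.single_eq_same]

lemma quadMinorant_div : quadMinorant s (v.1 / v.2) v = ∑ k ∈ s, v.1 k ^ 2 / v.2 k := by
  refine Finset.sum_congr rfl fun k _ => ?_
  rw [Pi.div_apply]
  rcases eq_or_ne (v.2 k) 0 with hk | hk
  · simp [hk]
  · field_simp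
    ring

lemma quadMinorant_smul_add_smul (c : κ → ℝ) (v w : (κ → ℝ) × (κ → ℝ)) (a b : ℝ) :
    quadMinorant s c (a • v + b • w) = a * quadMinorant s c v + b * quadMinorant s c w := by
  simp only [quadMinorant, Finset.mul_sum, ← Finset.sum_add_distrib]
  refine Finset.sum_congr rfl fun k _ => ?_
  simp only [Prod.fst_add, Prod.snd_add, Prod.smul_fst, Prod.smul_snd, Pi.add_apply, Pi.smul_apply,
    smul_eq_mul]
  ring

lemma continuous_quadMinorant (c : κ → ℝ) : Continuous (quadMinorant s c) := by
  unfold quadMinorant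
  fun_prop

lemma quadOverLin_le_iff (hd : ∀ k ∈ s, 0 ≤ v.2 k) {t : ℝ} :
    quadOverLin s v ≤ t ↔ ∀ c, quadMinorant s c v ≤ t := by
  classical
  constructor
  · intro h c
    rw [← EReal.coe_le_coe_iff, quadMinorant, coe_finset_sum_ereal]
    exact (Finset.sum_le_sum fun k hk => (extQuot_sq_le_iff (hd k hk)).1 le_rfl (c k)).trans h
  · intro h
    have hzero : ∀ k ∈ s, v.2 k = 0 → v.1 k = 0 := fun k hk =>
      eq_zero_of_extQuot_sq_le <| (extQuot_sq_le_iff (hd k hk)).2 fun r => by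
        rw [← quadMinorant_single hk, EReal.coe_le_coe_iff]
        exact h _
    refine le_trans (le_of_eq ?_) (EReal.coe_le_coe_iff.2 (h (v.1 / v.2)))
    rw [quadMinorant_div, coe_finset_sum_ereal]
    exact Finset.sum_congr rfl fun k hk =>
      extQuot_eq_coe_div fun hk0 => by simp [hzero k hk hk0]

lemma quadOverLin_smul_le {d : κ → ℝ} (hd : ∀ k ∈ s, 0 ≤ d k) (r : ℝ) :
    quadOverLin s (r • d, d) ≤ (r ^ 2 * ∑ k ∈ s, d k : ℝ) := by
  refine (quadOverLin_le_iff hd).2 fun c => ?_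
  rw [Finset.mul_sum]
  refine Finset.sum_le_sum fun k hk => ?_
  simp only [Pi.smul_apply, smul_eq_mul]
  linarith [mul_nonneg (hd k hk) (sq_nonneg (c k - r))]

/-- The pairs `(q, d)` supported on `s` whose denominators `d` have nonnegative entries of sum at
most `1`. Requiring the support to lie in `s` makes sublevel sets of `quadOverLin s` compact. -/
def subprobFractions (s : Finset κ) : Set ((κ → ℝ) × (κ → ℝ)) :=
  {v | (∀ k ∉ s, v.1 k = 0 ∧ v.2 k = 0) ∧ (∀ k, 0 ≤ v.2 k) ∧ ∑ k ∈ s, v.2 k ≤ 1}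

lemma isClosed_subprobFractions : IsClosed (subprobFractions s) := by
  simp only [subprobFractions, Set.ofPred_and, Set.ofPred_forall]
  refine .inter (isClosed_biInter fun k _ => .inter ?_ ?_) (.inter (isClosed_iInter fun k => ?_) ?_)
  · exact isClosed_eq (by fun_prop) (by fun_prop)
  · exact isClosed_eq (by fun_prop) (by fun_prop)
  · exact isClosed_le (by fun_prop) (by fun_prop)
  · exact isClosed_le (by fun_prop) (by fun_prop)

lemma convex_subprobFractions : Convex ℝ (subprobFractions s) := by
  intro v hv w hw a b ha hb hab
  refine ⟨fun k hk => by simp [hv.1 k hk, hw.1 k hk],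
    fun k => add_nonneg (mul_nonneg ha (hv.2.1 k)) (mul_nonneg hb (hw.2.1 k)), ?_⟩
  calc ∑ k ∈ s, (a • v + b • w).2 k = a * ∑ k ∈ s, v.2 k + b * ∑ k ∈ s, w.2 k := by
        simp [Finset.sum_add_distrib, Finset.mul_sum]
    _ ≤ a * 1 + b * 1 := by gcongr; exacts [hv.2.2, hw.2.2]
    _ = 1 := by rw [mul_one, mul_one, hab]

lemma mem_Icc_of_quadOverLin_le (hv : v ∈ subprobFractions s) {t : ℝ} (h : quadOverLin s v ≤ t) :
    v ∈ Set.Icc ((fun _ => -(t + 1), 0) : (κ → ℝ) × (κ → ℝ)) (fun _ => t + 1, 1) := by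
  classical
  obtain ⟨hsupp, hd, hsum⟩ := hv
  have hmin := (quadOverLin_le_iff fun k _ => hd k).1 h
  have ht : 0 ≤ t := by simpa [quadMinorant] using hmin 0
  have hd1 : ∀ k, v.2 k ≤ 1 := fun k => by
    by_cases hk : k ∈ s
    · exact (Finset.single_le_sum (fun j _ => hd j) hk).trans hsum
    · simp [hsupp k hk]
  have hq : ∀ k, |v.1 k| ≤ t + 1 := fun k => by
    by_cases hk : k ∈ s
    · have hpos := hmin (Pi.single k 1)
      have hneg := hmin (Pi.single k (-1))
      rw [quadMinorant_single hk] at hpos hneg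
      exact abs_le.2 ⟨by linarith [hd1 k], by linarith [hd1 k]⟩
    · rw [(hsupp k hk).1, abs_zero]
      linarith
  exact ⟨⟨fun k => (abs_le.1 (hq k)).1, hd⟩, ⟨fun k => (abs_le.1 (hq k)).2, hd1⟩⟩

lemma isClosed_setOf_exists_quadOverLin_le {P : Type*} [TopologicalSpace P]
    {W : Set (P × ((κ → ℝ) × (κ → ℝ)))} (hW : IsClosed W) (hWs : ∀ w ∈ W, w.2 ∈ subprobFractions s)
    {f : P → ℝ} (hf : Continuous f) :
    IsClosed {p | ∃ v, (p, v) ∈ W ∧ quadOverLin s v ≤ f p} := by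
  set A := {p | ∃ v, (p, v) ∈ W ∧ quadOverLin s v ≤ f p}
  refine isClosed_of_closure_subset fun p hp => ?_
  -- Near `p` the fractions stay in one compact box, and projection along a compact space is closed.
  let K : Set ((κ → ℝ) × (κ → ℝ)) := Set.Icc (fun _ => -(f p + 1 + 1), 0) (fun _ => f p + 1 + 1, 1)
  have : CompactSpace K := isCompact_iff_compactSpace.1 isCompact_Icc
  let C : Set (P × K) := {w | (w.1, w.2.1) ∈ W ∧ ∀ c, quadMinorant s c w.2.1 ≤ f w.1}
  have hC : IsClosed C := by
    simp only [C, Set.ofPred_and, Set.ofPred_forall]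
    exact .inter (hW.preimage (by fun_prop)) <| isClosed_iInter fun c =>
      isClosed_le ((continuous_quadMinorant c).comp (by fun_prop)) (by fun_prop)
  have himage : IsClosed (Prod.fst '' C) := isClosedMap_fst_of_compactSpace _ hC
  have himageA : Prod.fst '' C ⊆ A := by
    rintro _ ⟨w, ⟨hwW, hw⟩, rfl⟩
    exact ⟨w.2.1, hwW, (quadOverLin_le_iff fun k _ => (hWs _ hwW).2.1 k).2 hw⟩
  have hlocal : {p' | f p' < f p + 1} ∩ A ⊆ Prod.fst '' C := by
    rintro p' ⟨hp', v, hvW, hv⟩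
    have hvs := hWs _ hvW
    have hvK : v ∈ K := mem_Icc_of_quadOverLin_le hvs
      (hv.trans (EReal.coe_le_coe_iff.2 (le_of_lt hp')))
    exact ⟨(p', ⟨v, hvK⟩), ⟨hvW, (quadOverLin_le_iff fun k _ => hvs.2.1 k).1 hv⟩, rfl⟩
  have hopen : IsOpen {p' | f p' < f p + 1} := isOpen_lt hf continuous_const
  exact himageA (closure_minimal hlocal himage
    (hopen.inter_closure ⟨by simp, hp⟩))

lemma exists_isMinOn_quadOverLin {F : Set ((κ → ℝ) × (κ → ℝ))} (hF : IsClosed F)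
    (hFs : F ⊆ subprobFractions s) {v : (κ → ℝ) × (κ → ℝ)} (hv : v ∈ F) {t : ℝ}
    (hvt : quadOverLin s v ≤ t) : ∃ w ∈ F, IsMinOn (quadOverLin s) F w := by
  let T : Set ℝ := {r | ∃ w, (r, w) ∈ (Set.univ ×ˢ F : Set (ℝ × _)) ∧ quadOverLin s w ≤ r}
  have hT : IsClosed T := isClosed_setOf_exists_quadOverLin_le (isClosed_univ.prod hF)
    (fun w hw => hFs hw.2) continuous_id
  have hbdd : BddBelow T := ⟨0, fun r ⟨w, hw, hwr⟩ => EReal.coe_nonneg.1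
    ((quadOverLin_nonneg fun k _ => (hFs hw.2).2.1 k).trans hwr)⟩
  obtain ⟨w, hw, hwT⟩ : sInf T ∈ T := hT.csInf_mem ⟨t, v, ⟨trivial, hv⟩, hvt⟩ hbdd
  refine ⟨w, hw.2, fun u hu => EReal.le_of_forall_lt_iff_le.1 fun r hr => hwT.trans ?_⟩
  exact EReal.coe_le_coe_iff.2 (csInf_le hbdd ⟨u, ⟨trivial, hu⟩, hr.le⟩)

end Fractions

section Slots

variable {ι : Type*} {M L R U : Finset ι} {x y : ι → ℝ}

/-- The indices of the fractions of `auxObjective`: `inl i` for the items `i ∈ R`, and `inr 0` and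
`inr 1` for the aggregated fractions of `L` and `U`. -/
def slots (R : Finset ι) : Finset (ι ⊕ Fin 2) := R.disjSum Finset.univ

lemma sum_slots {A : Type*} [AddCommMonoid A] (R : Finset ι) (f : ι ⊕ Fin 2 → A) :
    ∑ k ∈ slots R, f k = ∑ i ∈ R, f (.inl i) + (f (.inr 0) + f (.inr 1)) := by
  rw [slots, Finset.sum_disjSum, Fin.sum_univ_two]

section

variable [DecidableEq ι]

/-- The family over `slots R` with entries `a i` at the items of `R` and `α` at the two aggregated
indices, extended by zero to the items outside `R`. -/
def slotVector (R : Finset ι) (a : ι → ℝ) (α : Fin 2 → ℝ) : ι ⊕ Fin 2 → ℝ :=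
  Sum.elim (R.piecewise a 0) α

variable {a b : ι → ℝ} {α β : Fin 2 → ℝ}

lemma slotVector_inl (a : ι → ℝ) (α : Fin 2 → ℝ) {i : ι} (hi : i ∈ R) :
    slotVector R a α (.inl i) = a i :=
  R.piecewise_eq_of_mem _ _ hi

lemma sum_slotVector : ∑ k ∈ slots R, slotVector R a α k = ∑ i ∈ R, a i + (α 0 + α 1) := by
  rw [sum_slots, Finset.sum_congr rfl fun i hi => slotVector_inl a α hi]
  rfl

lemma quadOverLin_slotVector :
    quadOverLin (slots R) (slotVector R a α, slotVector R b β) =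
      ∑ i ∈ R, extQuot (a i ^ 2) (b i) +
        (extQuot (α 0 ^ 2) (β 0) + extQuot (α 1 ^ 2) (β 1)) := by
  rw [quadOverLin, sum_slots]
  congr 1
  exact Finset.sum_congr rfl fun i hi => by simp only [slotVector_inl _ _ hi]

lemma slotVector_mem_subprobFractions (hb : ∀ i ∈ R, 0 ≤ b i) (hβ : 0 ≤ β)
    (hsum : ∑ k ∈ slots R, slotVector R b β k ≤ 1) :
    (slotVector R a α, slotVector R b β) ∈ subprobFractions (slots R) := by
  refine ⟨?_, ?_, hsum⟩
  · rintro (i | j) hk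
    · have hi : i ∉ R := by simpa [slots] using hk
      simp [slotVector, hi]
    · simp [slots] at hk
  · rintro (i | j)
    · by_cases hi : i ∈ R
      · simpa only [slotVector_inl b β hi] using hb i hi
      · simp [slotVector, hi]
    · exact hβ j

end

/-- The numerators and denominators that `auxObjective` can take on feasible points. The
denominators always sum to `1`, which is why this is a part of `subprobFractions`. -/
def slotRegion (M L R U : Finset ι) (x y : ι → ℝ) : Set ((ι ⊕ Fin 2 → ℝ) × (ι ⊕ Fin 2 → ℝ)) :=
  {v | v ∈ subprobFractions (slots R) ∧
    (∀ i ∈ R, v.1 (.inl i) ≤ y i) ∧ v.1 (.inr 0) ≤ ∑ i ∈ L, y i ∧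
    ∑ i ∈ L, y i + ∑ i ∈ R, y i + ∑ i ∈ U, y i - ∑ i ∈ M, y i ≤ ∑ k ∈ slots R, v.1 k ∧
    (∀ i ∈ R, v.2 (.inl i) ≤ x i) ∧ v.2 (.inr 1) ≤ ∑ i ∈ U, x i ∧
    ∑ k ∈ slots R, v.2 k = 1}

lemma isClosed_slotRegion : IsClosed (slotRegion M L R U x y) := by
  simp only [slotRegion, Set.ofPred_and, Set.ofPred_forall]
  refine .inter isClosed_subprobFractions (.inter (isClosed_biInter fun i _ => ?_) (.inter ?_
    (.inter ?_ (.inter (isClosed_biInter fun i _ => ?_) (.inter ?_ ?_)))))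
  iterate 5 exact isClosed_le (by fun_prop) (by fun_prop)
  exact isClosed_eq (by fun_prop) (by fun_prop)

lemma exists_mem_slotRegion_of_auxFeasible {lam mu : ι → ℝ} {lam0 mu0 zeta : ℝ}
    (h : AuxFeasible R U x lam mu lam0 mu0 zeta) :
    ∃ v ∈ slotRegion M L R U x y,
      quadOverLin (slots R) v = auxObjective M L R U x y lam mu lam0 mu0 zeta := by
  classical
  let α : Fin 2 → ℝ :=
    ![∑ i ∈ L, y i - lam0, ∑ i ∈ U, y i - ∑ i ∈ M, y i + lam0 + ∑ i ∈ R, lam i + zeta]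
  let β : Fin 2 → ℝ :=
    ![1 - ∑ i ∈ R, x i - ∑ i ∈ U, x i + ∑ i ∈ R, mu i + mu0, ∑ i ∈ U, x i - mu0]
  have hβ : 0 ≤ β := Fin.forall_fin_two.2 ⟨h.denom_nonneg, sub_nonneg.2 h.mu0_le⟩
  have hdenom : ∑ k ∈ slots R, slotVector R (x - mu) β k = 1 := by
    simp only [sum_slotVector, Pi.sub_apply, Finset.sum_sub_distrib, β, Matrix.cons_val_zero,
      Matrix.cons_val_one]
    ring
  refine ⟨(slotVector R (y - lam) α, slotVector R (x - mu) β),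
    ⟨slotVector_mem_subprobFractions (fun i hi => sub_nonneg.2 (h.mu_le i hi)) hβ hdenom.le,
      fun i hi => ?_, sub_le_self _ h.lam0_nonneg, ?_, fun i hi => ?_, sub_le_self _ h.mu0_nonneg,
      hdenom⟩, ?_⟩
  · exact (slotVector_inl _ α hi).trans_le (sub_le_self _ (h.lam_nonneg i hi))
  · simp only [sum_slotVector, Pi.sub_apply, Finset.sum_sub_distrib, α, Matrix.cons_val_zero,
      Matrix.cons_val_one]
    linarith [h.zeta_nonneg]
  · exact (slotVector_inl _ β hi).trans_le (sub_le_self _ (h.mu_nonneg i hi))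
  · rw [quadOverLin_slotVector, auxObjective, add_left_comm, ← add_assoc]
    rfl

lemma exists_auxFeasible_of_mem_slotRegion {v : (ι ⊕ Fin 2 → ℝ) × (ι ⊕ Fin 2 → ℝ)}
    (hv : v ∈ slotRegion M L R U x y) :
    ∃ (lam mu : ι → ℝ) (lam0 mu0 zeta : ℝ), AuxFeasible R U x lam mu lam0 mu0 zeta ∧
      quadOverLin (slots R) v = auxObjective M L R U x y lam mu lam0 mu0 zeta := by
  obtain ⟨⟨-, hd, -⟩, hqR, hqL, hq_sum, hdR, hdU, hd_sum⟩ := hv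
  rw [sum_slots] at hq_sum hd_sum
  have hdenom : 1 - ∑ i ∈ R, x i - ∑ i ∈ U, x i + ∑ i ∈ R, (x i - v.2 (.inl i)) +
      (∑ i ∈ U, x i - v.2 (.inr 1)) = v.2 (.inr 0) := by
    rw [Finset.sum_sub_distrib]
    linarith
  refine ⟨fun i => y i - v.1 (.inl i), fun i => x i - v.2 (.inl i),
    ∑ i ∈ L, y i - v.1 (.inr 0), ∑ i ∈ U, x i - v.2 (.inr 1),
    ∑ i ∈ R, v.1 (.inl i) + (v.1 (.inr 0) + v.1 (.inr 1)) -
      (∑ i ∈ L, y i + ∑ i ∈ R, y i + ∑ i ∈ U, y i - ∑ i ∈ M, y i), ⟨?_, ?_, ?_, ?_, ?_, ?_, ?_, ?_⟩,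
    ?_⟩
  · exact hdenom ▸ hd _
  · exact fun i _ => sub_le_self _ (hd _)
  · exact sub_le_self _ (hd _)
  · exact fun i hi => sub_nonneg.2 (hqR i hi)
  · exact fun i hi => sub_nonneg.2 (hdR i hi)
  · exact sub_nonneg.2 hqL
  · exact sub_nonneg.2 hdU
  · exact sub_nonneg.2 hq_sum
  · rw [quadOverLin, sum_slots, auxObjective, hdenom, add_left_comm, ← add_assoc]
    simp only [sub_sub_cancel, Finset.sum_sub_distrib]
    congr 3
    ring

lemma extendedIneq_iff {t : ℝ} :
    ExtendedIneq M L R U x y t ↔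
      ∃ v ∈ slotRegion M L R U x y, quadOverLin (slots R) v ≤ t := by
  constructor
  · rintro ⟨w, ⟨⟨lam, mu, lam0, mu0, zeta, hfeas, rfl⟩, -⟩, hw⟩
    obtain ⟨v, hv, hval⟩ := exists_mem_slotRegion_of_auxFeasible hfeas
    exact ⟨v, hv, hval.trans_le hw⟩
  · rintro ⟨v, hv, hvt⟩
    obtain ⟨w, hw, hmin⟩ := exists_isMinOn_quadOverLin isClosed_slotRegion (fun _ h => h.1) hv hvt
    obtain ⟨lam, mu, lam0, mu0, zeta, hfeas, hval⟩ := exists_auxFeasible_of_mem_slotRegion hw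
    refine ⟨quadOverLin (slots R) w, ⟨⟨lam, mu, lam0, mu0, zeta, hfeas, hval⟩, ?_⟩,
      (hmin hv).trans hvt⟩
    rintro _ ⟨lam', mu', lam0', mu0', zeta', hfeas', rfl⟩
    obtain ⟨u, hu, hval'⟩ := exists_mem_slotRegion_of_auxFeasible hfeas'
    exact hval' ▸ hmin hu

end Slots

section Relaxation

variable {ι : Type*} {S M L R U : Finset ι}

lemma IsTripartition.sum_eq [DecidableEq ι] {A : Type*} [AddCommMonoid A]
    (h : IsTripartition S L R U) (f : ι → A) :
    ∑ i ∈ S, f i = ∑ i ∈ L, f i + ∑ i ∈ R, f i + ∑ i ∈ U, f i := by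
  rw [← h.union_eq,
    Finset.sum_union (Finset.disjoint_union_left.2 ⟨h.disjoint_L_U, h.disjoint_R_U⟩),
    Finset.sum_union h.disjoint_L_R]

/-- The relaxation of `rankOneSet S M` in which disjoint events of probabilities `v.2 i ≤ x i`
carry the parts `v.1 i ≤ y i` of the variables of `S`. It is what `ExtendedIneq` says for the
tripartition `(∅, S, ∅)`. -/
def splitSet (S M : Finset ι) : Set ((ι → ℝ) × (ι → ℝ) × ℝ) :=
  {p | ∃ v ∈ subprobFractions S, (∀ i ∈ S, v.1 i ≤ p.2.1 i) ∧
    ∑ i ∈ S, p.2.1 i - ∑ i ∈ M, p.2.1 i ≤ ∑ i ∈ S, v.1 i ∧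
    (∀ i ∈ S, v.2 i ≤ p.1 i) ∧ quadOverLin S v ≤ p.2.2}

lemma isClosed_splitSet : IsClosed (splitSet S M) := by
  let W : Set (((ι → ℝ) × (ι → ℝ) × ℝ) × ((ι → ℝ) × (ι → ℝ))) :=
    {w | w.2 ∈ subprobFractions S ∧ (∀ i ∈ S, w.2.1 i ≤ w.1.2.1 i) ∧
      ∑ i ∈ S, w.1.2.1 i - ∑ i ∈ M, w.1.2.1 i ≤ ∑ i ∈ S, w.2.1 i ∧ ∀ i ∈ S, w.2.2 i ≤ w.1.1 i}
  have hW : IsClosed W := by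
    simp only [W, Set.ofPred_and, Set.ofPred_forall]
    refine .inter (isClosed_subprobFractions.preimage continuous_snd)
      (.inter (isClosed_biInter fun i _ => ?_) (.inter ?_ (isClosed_biInter fun i _ => ?_)))
    all_goals exact isClosed_le (by fun_prop) (by fun_prop)
  have hclosed := isClosed_setOf_exists_quadOverLin_le hW (fun _ hw => hw.1)
    (f := fun p => p.2.2) (by fun_prop)
  simp only [W, Set.mem_ofPred_eq, and_assoc] at hclosed
  exact hclosed

lemma convex_splitSet : Convex ℝ (splitSet S M) := by
  rintro p ⟨v, hv, hvy, hvsum, hvx, hvt⟩ p' ⟨w, hw, hwy, hwsum, hwx, hwt⟩ a b ha hb hab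
  have hconv := convex_subprobFractions hv hw ha hb hab
  refine ⟨a • v + b • w, hconv, fun i hi => ?_, ?_, fun i hi => ?_, ?_⟩
  · exact add_le_add (mul_le_mul_of_nonneg_left (hvy i hi) ha)
      (mul_le_mul_of_nonneg_left (hwy i hi) hb)
  · have := add_le_add (mul_le_mul_of_nonneg_left hvsum ha) (mul_le_mul_of_nonneg_left hwsum hb)
    simp only [Prod.snd_add, Prod.fst_add, Prod.smul_snd, Prod.smul_fst, Pi.add_apply,
      Pi.smul_apply, smul_eq_mul, Finset.sum_add_distrib, ← Finset.mul_sum]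
    linarith
  · exact add_le_add (mul_le_mul_of_nonneg_left (hvx i hi) ha)
      (mul_le_mul_of_nonneg_left (hwx i hi) hb)
  · refine (quadOverLin_le_iff fun k _ => hconv.2.1 k).2 fun c => ?_
    rw [quadMinorant_smul_add_smul]
    exact add_le_add
      (mul_le_mul_of_nonneg_left ((quadOverLin_le_iff fun k _ => hv.2.1 k).1 hvt c) ha)
      (mul_le_mul_of_nonneg_left ((quadOverLin_le_iff fun k _ => hw.2.1 k).1 hwt c) hb)

lemma mem_splitSet_of_extendedIneq {x y : ι → ℝ} {t : ℝ} (h : ExtendedIneq M ∅ S ∅ x y t) :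
    (x, y, t) ∈ splitSet S M := by
  obtain ⟨v, ⟨⟨hsupp, hd, hd1⟩, hqS, hqL, hq_sum, hdS, hdU, -⟩, hvt⟩ := extendedIneq_iff.1 h
  have hqU : v.1 (.inr 1) = 0 := eq_zero_of_extQuot_sq_le
    ((extQuot_le_quadOverLin (fun k _ => hd k) (by simp [slots])).trans hvt)
    (le_antisymm (by simpa using hdU) (hd _))
  simp only [Finset.sum_empty, zero_add, add_zero, sum_slots, hqU] at hqL hq_sum hd1
  refine ⟨(fun i => v.1 (.inl i), fun i => v.2 (.inl i)),
    ⟨fun i hi => hsupp _ (by simpa [slots] using hi), fun i => hd _, ?_⟩, hqS, ?_, hdS, ?_⟩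
  · linarith [hd (.inr 0), hd (.inr 1)]
  · linarith
  · refine le_trans ?_ hvt
    rw [quadOverLin, quadOverLin, sum_slots]
    exact le_add_of_nonneg_right (add_nonneg (extQuot_nonneg (sq_nonneg _) (hd _))
      (extQuot_nonneg (sq_nonneg _) (hd _)))

lemma extendedIneq_of_mem_splitSet [DecidableEq ι] (hS : IsTripartition S L R U) {x y : ι → ℝ}
    {t : ℝ} (h : (x, y, t) ∈ splitSet S M) : ExtendedIneq M L R U x y t := by
  obtain ⟨v, ⟨-, hd, hd1⟩, hqy, hq_sum, hdx, hvt⟩ := h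
  rw [hS.sum_eq] at hd1
  simp only [hS.sum_eq] at hq_sum
  have hsub : L ⊆ S ∧ R ⊆ S ∧ U ⊆ S := by
    simpa only [Finset.union_subset_iff, and_assoc] using hS.union_eq.subset
  let α : Fin 2 → ℝ := ![∑ i ∈ L, v.1 i, ∑ i ∈ U, v.1 i]
  let β : Fin 2 → ℝ := ![1 - ∑ i ∈ R, v.2 i - ∑ i ∈ U, v.2 i, ∑ i ∈ U, v.2 i]
  have hdL : 0 ≤ ∑ i ∈ L, v.2 i := Finset.sum_nonneg fun i _ => hd i
  have hdL' : ∑ i ∈ L, v.2 i ≤ β 0 := by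
    simp only [β, Matrix.cons_val_zero]
    linarith
  have hβ : 0 ≤ β := Fin.forall_fin_two.2
    ⟨hdL.trans hdL', Finset.sum_nonneg fun i _ => hd i⟩
  have hdenom : ∑ k ∈ slots R, slotVector R v.2 β k = 1 := by
    simp [sum_slotVector, β]
  refine extendedIneq_iff.2 ⟨(slotVector R v.1 α, slotVector R v.2 β),
    ⟨slotVector_mem_subprobFractions (fun i _ => hd i) hβ hdenom.le,
      fun i hi => (slotVector_inl v.1 α hi).trans_le (hqy i (hsub.2.1 hi)),
      Finset.sum_le_sum fun i hi => hqy i (hsub.1 hi), ?_,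
      fun i hi => (slotVector_inl v.2 β hi).trans_le (hdx i (hsub.2.1 hi)),
      Finset.sum_le_sum fun i hi => hdx i (hsub.2.2 hi), hdenom⟩, le_trans ?_ hvt⟩
  · simp only [sum_slotVector, α, Matrix.cons_val_zero, Matrix.cons_val_one]
    linarith
  · rw [quadOverLin_slotVector, quadOverLin, hS.sum_eq, add_left_comm, ← add_assoc]
    gcongr
    · exact (extQuot_sq_le_of_denom_le hdL hdL').trans (extQuot_sq_sum_le fun i _ => hd i)
    · exact extQuot_sq_sum_le fun i _ => hd i

lemma rankOneSet_subset_splitSet : rankOneSet S M ⊆ splitSet S M := by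
  classical
  rintro ⟨x, y, t⟩ ⟨hx, hy, -, ht, hxy⟩
  simp only at hx hy ht hxy
  set Y := ∑ i ∈ S, y i
  set s := Y - ∑ i ∈ M, y i
  have hY : 0 ≤ Y := Finset.sum_nonneg fun i _ => hy i
  have hsY : max s 0 ≤ Y := max_le (sub_le_self _ (Finset.sum_nonneg fun i _ => hy i)) hY
  let d : ι → ℝ := S.piecewise (fun i => y i / Y) 0
  have hd : ∀ i ∈ S, d i = y i / Y := fun i hi => S.piecewise_eq_of_mem _ _ hi
  have hd0 : ∀ i, 0 ≤ d i := fun i => by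
    by_cases hi : i ∈ S
    · exact hd i hi ▸ div_nonneg (hy i) hY
    · simp [d, hi]
  have hd_sum : ∑ i ∈ S, d i = Y / Y := by
    rw [Finset.sum_congr rfl hd, ← Finset.sum_div]
  have hd1 : ∑ i ∈ S, d i ≤ 1 := hd_sum ▸ div_self_le_one Y
  refine ⟨(max s 0 • d, d), ⟨fun i hi => by simp [d, hi], hd0, hd1⟩, fun i hi => ?_, ?_,
    fun i hi => ?_, (quadOverLin_smul_le (fun i _ => hd0 i) _).trans (EReal.coe_le_coe_iff.2 ?_)⟩
  · calc max s 0 * d i = y i * (max s 0 / Y) := by rw [hd i hi]; ring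
      _ ≤ y i := mul_le_of_le_one_right (hy i) (div_le_one_of_le₀ hsY hY)
  · simp only [Pi.smul_apply, smul_eq_mul]
    rw [← Finset.mul_sum, hd_sum]
    change s ≤ max s 0 * (Y / Y)
    rcases hY.eq_or_lt with hY0 | hY0
    · rw [← hY0, div_zero, mul_zero]
      exact ((le_max_left s 0).trans hsY).trans_eq hY0.symm
    · rw [div_self hY0.ne', mul_one]
      exact le_max_left s 0
  · rcases hx i with hi0 | hi1
    · have hyi : y i = 0 := by simpa [hi0] using hxy i
      simp [hd i hi, hi0, hyi]
    · exact ((Finset.single_le_sum (fun j _ => hd0 j) hi).trans hd1).trans_eq hi1.symm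
  · calc max s 0 ^ 2 * ∑ i ∈ S, d i ≤ max s 0 ^ 2 := mul_le_of_le_one_right (sq_nonneg _) hd1
      _ ≤ s ^ 2 := by
        rw [← sq_abs s]
        gcongr
        exact max_le (le_abs_self s) (abs_nonneg s)
      _ ≤ t := ht

lemma forall_extendedIneq_iff [DecidableEq ι] {x y : ι → ℝ} {t : ℝ} :
    (∀ L R U : Finset ι, IsTripartition S L R U → ExtendedIneq M L R U x y t) ↔
      (x, y, t) ∈ splitSet S M :=
  ⟨fun h => mem_splitSet_of_extendedIneq (h ∅ S ∅ ⟨by simp, by simp, by simp, by simp⟩),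
    fun h _ _ _ hS => extendedIneq_of_mem_splitSet hS h⟩

end Relaxation

section Hull

lemma pi_convexHull_subset_of_isClosed {ι : Type*} {E : ι → Type*} [∀ i, AddCommGroup (E i)]
    [∀ i, Module ℝ (E i)] [∀ i, TopologicalSpace (E i)] {K : Set (∀ i, E i)} (hK : Convex ℝ K)
    (hKc : IsClosed K) {B : ∀ i, Set (E i)} (hB : Set.univ.pi B ⊆ K) :
    Set.univ.pi (fun i => convexHull ℝ (B i)) ⊆ K := by
  classical
  have hfinite : ∀ F : Finset ι,
      Set.univ.pi (fun i => if i ∈ F then convexHull ℝ (B i) else B i) ⊆ K := fun F => by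
    induction F using Finset.induction_on with
    | empty => simpa using hB
    | insert k F hk ih =>
      intro x hx
      have hline : Convex ℝ {r | Function.update x k r ∈ K} := by
        intro r hr r' hr' a b ha hb hab
        change Function.update x k (a • r + b • r') ∈ K
        nth_rewrite 1 [← Convex.combo_self hab x]
        rw [Function.update_add, Function.update_smul, Function.update_smul]
        exact hK hr hr' ha hb hab
      have hxk : x k ∈ convexHull ℝ (B k) := by simpa using hx k trivial
      have hvertices : B k ⊆ {r | Function.update x k r ∈ K} := by
        refine fun r hr => ih fun i _ => ?_
        rcases eq_or_ne i k with rfl | hik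
        · simpa [hk] using hr
        · simpa [hik] using hx i trivial
      simpa using convexHull_min hvertices hline hxk
  intro x hx
  choose b hb using fun i => convexHull_nonempty_iff.1 ⟨x i, hx i trivial⟩
  have hlim : Tendsto (fun F : Finset ι => F.piecewise x b) atTop (𝓝 x) :=
    tendsto_pi_nhds.2 fun i => tendsto_const_nhds.congr' <|
      (eventually_ge_atTop {i}).mono fun F hF =>
        (F.piecewise_eq_of_mem _ _ (Finset.singleton_subset_iff.1 hF)).symm
  refine hKc.mem_of_tendsto hlim (Eventually.of_forall fun F => hfinite F fun i _ => ?_)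
  by_cases hi : i ∈ F
  · simpa [hi] using hx i trivial
  · simpa [hi] using hb i

lemma convex_smul_add_sum_smul_mem {E κ : Type*} [AddCommGroup E] [Module ℝ E] {K : Set E}
    (hK : Convex ℝ K) {s : Finset κ} {w : κ → ℝ} {p : E} {P : κ → E} (hw : ∀ k ∈ s, 0 ≤ w k)
    (hw1 : ∑ k ∈ s, w k ≤ 1) (hp : p ∈ K) (hP : ∀ k ∈ s, P k ∈ K) :
    (1 - ∑ k ∈ s, w k) • p + ∑ k ∈ s, w k • P k ∈ K := by
  have hmem := hK.sum_mem (t := Finset.insertNone s)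
    (w := fun o => o.elim (1 - ∑ k ∈ s, w k) w) (z := fun o => o.elim p P)
    (Finset.forall_mem_insertNone.2 ⟨sub_nonneg.2 hw1, hw⟩) (by simp [Finset.sum_insertNone])
    (Finset.forall_mem_insertNone.2 ⟨hp, hP⟩)
  simpa only [Finset.sum_insertNone, Option.elim] using hmem

variable {ι : Type*} {S M : Finset ι} {x y : ι → ℝ} {t : ℝ}

lemma rankOneSet_comm (S M : Finset ι) : rankOneSet S M = rankOneSet M S := by
  simp only [rankOneSet, sub_sq_comm]

lemma mem_closedConvexHull_rankOneSet_of_complementary (hx : ∀ i, 0 ≤ x i ∧ x i ≤ 1)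
    (hy : ∀ i, 0 ≤ y i) (hxy : ∀ i, y i * (1 - x i) = 0)
    (ht : (∑ i ∈ S, y i - ∑ i ∈ M, y i) ^ 2 ≤ t) :
    (x, y, t) ∈ closedConvexHull ℝ (rankOneSet S M) := by
  let B : ι → Set ℝ := fun i => {r | (r = 0 ∨ r = 1) ∧ y i * (1 - r) = 0}
  let K : Set (ι → ℝ) := {x' | (x', y, t) ∈ closedConvexHull ℝ (rankOneSet S M)}
  have hK : Convex ℝ K := fun u hu w hw a b ha hb hab => by
    have := convex_closedConvexHull hu hw ha hb hab
    simpa [K, ← add_smul, ← add_mul, hab] using this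
  have hKc : IsClosed K := isClosed_closedConvexHull.preimage (by fun_prop)
  refine pi_convexHull_subset_of_isClosed hK hKc (B := B) (fun x' hx' => ?_) fun i _ => ?_
  · exact subset_closedConvexHull ⟨fun i => (hx' i trivial).1, hy, (sq_nonneg _).trans ht, ht,
      fun i => (hx' i trivial).2⟩
  · rcases mul_eq_zero.1 (hxy i) with hyi | hxi
    · have hB : B i = {0, 1} := by ext; simp [B, hyi]
      change x i ∈ convexHull ℝ (B i)
      rw [hB, convexHull_pair, segment_eq_Icc zero_le_one]
      exact hx i
    · have hxi1 : x i = 1 := by linarith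
      exact subset_convexHull ℝ _ ⟨Or.inr hxi1, hxy i⟩

lemma add_mem_closedConvexHull_rankOneSet {r : ι → ℝ} {u : ℝ}
    (h : (x, y, t) ∈ closedConvexHull ℝ (rankOneSet S M)) (hr : ∀ i, 0 ≤ r i)
    (hbal : ∑ i ∈ S, r i = ∑ i ∈ M, r i) (hu : 0 ≤ u) :
    (x, y + r, t + u) ∈ closedConvexHull ℝ (rankOneSet S M) := by
  let dir : (ι → ℝ) × (ι → ℝ) × ℝ := (0, r, u)
  have hray : ∀ c : ℝ, 0 ≤ c → c • dir +ᵥ ((1, 0, 0) : (ι → ℝ) × (ι → ℝ) × ℝ) ∈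
      rankOneSet S M := fun c hc =>
    ⟨fun i => by simp [dir], fun i => by simpa [dir] using mul_nonneg hc (hr i),
      by simpa [dir] using mul_nonneg hc hu,
      by simpa [dir, ← Finset.mul_sum, hbal] using mul_nonneg hc hu, fun i => by simp [dir]⟩
  have hdir : dir ∈ asymptoticCone ℝ (closedConvexHull ℝ (rankOneSet S M)) :=
    asymptoticCone_mono subset_closedConvexHull <|
      (tendsto_id.atTop_smul_const_tendsto_asymptoticNhds dir).asymptoticNhds_vadd_const _
        |>.frequently ((eventually_ge_atTop (0 : ℝ)).mono hray).frequently
  have := convex_closedConvexHull.smul_vadd_mem_of_isClosed_of_mem_asymptoticCone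
    isClosed_closedConvexHull zero_le_one hdir h
  simpa [dir, add_comm] using this

lemma sum_mul_update [DecidableEq ι] {d ρ : ι → ℝ} (hdS : ∀ i ∉ S, d i = 0) (a : ℝ) (j : ι) :
    ∑ k ∈ S, d k * Function.update ρ k a j = (∑ k ∈ S, d k) * ρ j + d j * (a - ρ j) := by
  have hterm : ∀ k, d k * Function.update ρ k a j =
      d k * ρ j + if j = k then d j * (a - ρ j) else 0 := fun k => by
    rcases eq_or_ne j k with rfl | hjk
    · simp
      ring
    · simp [hjk]
  rw [Finset.sum_congr rfl fun k _ => hterm k, Finset.sum_add_distrib, ← Finset.sum_mul,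
    Finset.sum_ite_eq]
  by_cases hj : j ∈ S <;> simp [hj, hdS]

lemma update_single_mem_closedConvexHull_rankOneSet [DecidableEq ι] (hSM : Disjoint S M)
    (hx : ∀ i, 0 ≤ x i ∧ x i ≤ 1) {k : ι} (hk : k ∈ S) {a : ℝ} (ha : 0 ≤ a) :
    (Function.update x k 1, Pi.single k a, a ^ 2) ∈ closedConvexHull ℝ (rankOneSet S M) := by
  have hkM : k ∉ M := Finset.disjoint_left.1 hSM hk
  have hsingle : (0 : ι → ℝ) ≤ Pi.single k a := Pi.single_nonneg.2 ha
  refine mem_closedConvexHull_rankOneSet_of_complementary (fun i => ?_) hsingle (fun i => ?_)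
    (by simp [hk, hkM])
  · rcases eq_or_ne i k with rfl | hik
    · simp
    · simpa [hik] using hx i
  · rcases eq_or_ne i k with rfl | hik <;> simp [*]

lemma mem_closedConvexHull_rankOneSet_of_subprobFractions (hSM : Disjoint S M)
    {v : (ι → ℝ) × (ι → ℝ)} (hv : v ∈ subprobFractions S) (hx : ∀ i, 0 ≤ x i ∧ x i ≤ 1)
    (hq : ∀ i, 0 ≤ v.1 i) (hdx : ∀ i, v.2 i ≤ x i) (hdq : ∀ i, v.2 i = 0 → v.1 i = 0) :
    (x, v.1, ∑ i ∈ S, v.1 i ^ 2 / v.2 i) ∈ closedConvexHull ℝ (rankOneSet S M) := by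
  classical
  obtain ⟨q, d⟩ := v
  obtain ⟨hsupp, hd, hd1⟩ := hv
  simp only at hsupp hd hd1 hq hdx hdq ⊢
  -- `ρ j` is the probability that `x j = 1` outside the `j`-th event.
  let ρ : ι → ℝ := fun j => (x j - d j) / (1 - d j)
  have hd_le : ∀ j, d j ≤ 1 := fun j => (hdx j).trans (hx j).2
  have hρ : ∀ j, 0 ≤ ρ j ∧ ρ j ≤ 1 := fun j =>
    ⟨div_nonneg (sub_nonneg.2 (hdx j)) (sub_nonneg.2 (hd_le j)),
      div_le_one_of_le₀ (sub_le_sub_right (hx j).2 _) (sub_nonneg.2 (hd_le j))⟩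
  have hρd : ∀ j, ρ j * (1 - d j) = x j - d j := fun j =>
    div_mul_cancel_of_imp fun h => by linarith [hdx j, (hx j).2]
  have hnone : (ρ, 0, 0) ∈ closedConvexHull ℝ (rankOneSet S M) :=
    mem_closedConvexHull_rankOneSet_of_complementary hρ (by simp) (by simp) (by simp)
  have hsome : ∀ k ∈ S, (Function.update ρ k 1, Pi.single k (q k / d k), (q k / d k) ^ 2) ∈
      closedConvexHull ℝ (rankOneSet S M) := fun k hk =>
    update_single_mem_closedConvexHull_rankOneSet hSM hρ hk (div_nonneg (hq k) (hd k))
  convert convex_smul_add_sum_smul_mem convex_closedConvexHull (fun k _ => hd k) hd1 hnone hsome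
    using 1
  refine Prod.ext (funext fun j => ?_) (Prod.ext (funext fun j => ?_) ?_)
  · have hsum := sum_mul_update (fun i hi => (hsupp i hi).2) (ρ := ρ) 1 j
    simp only [Prod.fst_add, Prod.smul_fst, Prod.fst_sum, Pi.add_apply, Pi.smul_apply,
      Finset.sum_apply, smul_eq_mul, hsum]
    linarith [hρd j]
  · have hterm : ∀ k, d k * (Pi.single k (q k / d k) : ι → ℝ) j = if j = k then q j else 0 := by
      intro k
      rcases eq_or_ne j k with rfl | hjk
      · simp [mul_div_cancel_of_imp' (hdq j)]
      · simp [hjk]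
    by_cases hj : j ∈ S <;> simp [Prod.fst_sum, Prod.snd_sum, hterm, hj, hsupp]
  · have hterm : ∀ k, d k * (q k / d k) ^ 2 = q k ^ 2 / d k := fun k => by
      rcases eq_or_ne (d k) 0 with hk | hk
      · simp [hk]
      · field_simp
    simp [Prod.snd_sum, hterm]

lemma exists_exact_split_of_mem_splitSet (hy : ∀ i, 0 ≤ y i)
    (hMS : ∑ i ∈ M, y i ≤ ∑ i ∈ S, y i) (h : (x, y, t) ∈ splitSet S M) :
    ∃ v ∈ subprobFractions S, (∀ i, 0 ≤ v.1 i) ∧ (∀ i ∈ S, v.1 i ≤ y i) ∧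
      ∑ i ∈ S, v.1 i = ∑ i ∈ S, y i - ∑ i ∈ M, y i ∧ (∀ i ∈ S, v.2 i ≤ x i) ∧
      quadOverLin S v ≤ t := by
  obtain ⟨v, ⟨hsupp, hd, hd1⟩, hvy, hv_sum, hvx, hvt⟩ := h
  simp only at hvy hv_sum hvx hvt
  set s := ∑ i ∈ S, y i - ∑ i ∈ M, y i
  have hs : 0 ≤ s := sub_nonneg.2 hMS
  set Q := ∑ i ∈ S, max (v.1 i) 0
  have hsQ : s ≤ Q := hv_sum.trans (Finset.sum_le_sum fun i _ => le_max_left _ _)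
  let q : ι → ℝ := fun i => s / Q * max (v.1 i) 0
  have hq : ∀ i, 0 ≤ q i := fun i =>
    mul_nonneg (div_nonneg hs (hs.trans hsQ)) (le_max_right _ _)
  have hq_le : ∀ i, q i ≤ max (v.1 i) 0 := fun i =>
    mul_le_of_le_one_left (le_max_right _ _) (div_le_one_of_le₀ hsQ (hs.trans hsQ))
  refine ⟨(q, v.2), ⟨fun i hi => by simp [q, hsupp i hi], hd, hd1⟩, hq,
    fun i hi => (hq_le i).trans (max_le (hvy i hi) (hy i)), ?_, hvx, le_trans ?_ hvt⟩
  · rw [← Finset.mul_sum]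
    exact div_mul_cancel_of_imp fun hQ => le_antisymm (hsQ.trans_eq hQ) hs
  · refine Finset.sum_le_sum fun i _ => extQuot_le_extQuot_of_le (sq_nonneg _) (hd i) ?_
    refine sq_le_sq.2 ?_
    rw [abs_of_nonneg (hq i)]
    exact (hq_le i).trans (max_le (le_abs_self _) (abs_nonneg _))

lemma mem_closedConvexHull_of_mem_splitSet (hSM : Disjoint S M) (hx : ∀ i, 0 ≤ x i ∧ x i ≤ 1)
    (hy : ∀ i, 0 ≤ y i) (hMS : ∑ i ∈ M, y i ≤ ∑ i ∈ S, y i) (h : (x, y, t) ∈ splitSet S M) :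
    (x, y, t) ∈ closedConvexHull ℝ (rankOneSet S M) := by
  obtain ⟨v, hv, hq, hqy, hq_sum, hdx, hvt⟩ := exists_exact_split_of_mem_splitSet hy hMS h
  obtain ⟨hsupp, hd, -⟩ := id hv
  have hdx' : ∀ i, v.2 i ≤ x i := fun i => by
    by_cases hi : i ∈ S
    · exact hdx i hi
    · exact (hsupp i hi).2.trans_le (hx i).1
  have hqy' : ∀ i, v.1 i ≤ y i := fun i => by
    by_cases hi : i ∈ S
    · exact hqy i hi
    · exact (hsupp i hi).1.trans_le (hy i)
  have hdq : ∀ i, v.2 i = 0 → v.1 i = 0 := fun i hdi => by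
    by_cases hi : i ∈ S
    · exact eq_zero_of_extQuot_sq_le
        ((extQuot_le_quadOverLin (fun k _ => hd k) hi).trans hvt) hdi
    · exact (hsupp i hi).1
  have hsplit := mem_closedConvexHull_rankOneSet_of_subprobFractions hSM hv hx hq hdx' hdq
  have hqM : ∑ i ∈ M, v.1 i = 0 :=
    Finset.sum_eq_zero fun i hi => (hsupp i (Finset.disjoint_right.1 hSM hi)).1
  have hbal : ∑ i ∈ S, (y - v.1) i = ∑ i ∈ M, (y - v.1) i := by
    simp only [Pi.sub_apply, Finset.sum_sub_distrib, hq_sum, hqM]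
    ring
  have hcost : ∑ i ∈ S, v.1 i ^ 2 / v.2 i ≤ t := by
    rw [← quadMinorant_div]
    exact (quadOverLin_le_iff fun k _ => hd k).1 hvt _
  simpa using add_mem_closedConvexHull_rankOneSet (r := y - v.1) hsplit
    (fun i => sub_nonneg.2 (hqy' i)) hbal (sub_nonneg.2 hcost)

lemma closedConvexHull_rankOneSet (hSM : Disjoint S M) :
    closedConvexHull ℝ (rankOneSet S M) =
      {p | (∀ i, 0 ≤ p.1 i ∧ p.1 i ≤ 1) ∧ ∀ i, 0 ≤ p.2.1 i} ∩ (splitSet S M ∩ splitSet M S) := by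
  have hbox : {p : (ι → ℝ) × (ι → ℝ) × ℝ | (∀ i, 0 ≤ p.1 i ∧ p.1 i ≤ 1) ∧ ∀ i, 0 ≤ p.2.1 i} =
      Set.Icc 0 1 ×ˢ Set.Ici 0 ×ˢ Set.univ := by
    ext p
    simp [Pi.le_def, forall_and]
  refine Set.Subset.antisymm (closedConvexHull_min ?_ ?_ ?_) ?_
  · refine Set.subset_inter (fun p hp => ⟨fun i => ?_, hp.2.1⟩)
      (Set.subset_inter rankOneSet_subset_splitSet
        (rankOneSet_comm S M ▸ rankOneSet_subset_splitSet))
    rcases hp.1 i with hi | hi <;> simp [hi]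
  · rw [hbox]
    exact ((convex_Icc 0 1).prod ((convex_Ici 0).prod convex_univ)).inter
      (convex_splitSet.inter convex_splitSet)
  · rw [hbox]
    exact (isClosed_Icc.prod (isClosed_Ici.prod isClosed_univ)).inter
      (isClosed_splitSet.inter isClosed_splitSet)
  · rintro ⟨x, y, t⟩ ⟨⟨hx, hy⟩, hSM', hMS'⟩
    rcases le_total (∑ i ∈ M, y i) (∑ i ∈ S, y i) with hle | hle
    · exact mem_closedConvexHull_of_mem_splitSet hSM hx hy hle hSM'
    · rw [rankOneSet_comm]
      exact mem_closedConvexHull_of_mem_splitSet hSM.symm hx hy hle hMS'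

end Hull

theorem mainTheorem1_general {ι : Type*} [DecidableEq ι] (Np Nm : Finset ι)
    (hdisj : Disjoint Np Nm) :
    closure (convexHull ℝ (rankOneSet Np Nm)) =
      {p : (ι → ℝ) × (ι → ℝ) × ℝ |
        (∀ i, 0 ≤ p.1 i ∧ p.1 i ≤ 1) ∧ (∀ i, 0 ≤ p.2.1 i) ∧
        (∀ L R U : Finset ι, IsTripartition Np L R U →
          ExtendedIneq Nm L R U p.1 p.2.1 p.2.2) ∧
        (∀ L R U : Finset ι, IsTripartition Nm L R U →
          ExtendedIneq Np L R U p.1 p.2.1 p.2.2)} := by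
  rw [← closedConvexHull_eq_closure_convexHull, closedConvexHull_rankOneSet hdisj]
  ext ⟨x, y, t⟩
  simp only [forall_extendedIneq_iff, Set.mem_inter_iff, Set.mem_ofPred_eq, and_assoc]

theorem mainTheorem1 {ι : Type*} [Fintype ι] [DecidableEq ι] (Np Nm : Finset ι)
    (hdisj : Disjoint Np Nm) (hunion : Np ∪ Nm = Finset.univ) :
    closure (convexHull ℝ (rankOneSet Np Nm)) =
      {p : (ι → ℝ) × (ι → ℝ) × ℝ |
        (∀ i, 0 ≤ p.1 i ∧ p.1 i ≤ 1) ∧ (∀ i, 0 ≤ p.2.1 i) ∧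
        (∀ L R U : Finset ι, IsTripartition Np L R U →
          ExtendedIneq Nm L R U p.1 p.2.1 p.2.2) ∧
        (∀ L R U : Finset ι, IsTripartition Nm L R U →
          ExtendedIneq Np L R U p.1 p.2.1 p.2.2)} :=
  mainTheorem1_general Np Nm hdisj
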